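/- Let $\mathcal T_c$ be the class of all complete first-order theories $T$ in a countable language whose set $S(T)$ of complete types over $\varnothing$ (in finitely many variables) has cardinality $2^{\omega}$. A model $M$ of $T$ is prime over a tuple $\bar a\in M$ if for every model $N$ of $T$ and every $\bar b\in N$ with the same complete type as $\bar a$ there is an elementary embedding $M\to N$ mapping $\bar a$ to $\bar b$. A model of $T$ is limit if it is not prime over any finite tuple of its elements but is the union of an elementary chain $(M_n)_{n\in\omega}$ of models of $T$ each of which is prime over some finite tuple of its elements. Let $P(T)$, $L(T)$ and $\mathrm{NPL}(T)$ be the numbers of isomorphism types of countable models of $T$ that are, respectively, prime over some finite tuple, limit, and neither of the two, and put $\mathrm{cm}_3(T)=(P(T),L(T),\mathrm{NPL}(T))$. Proposition 5.4. There is no theory $T\in\mathcal T_c$ such that $\mathrm{cm}_3(T)$ has any of the following forms: (1) $(\lambda_1,2^{\omega},\lambda_3)$, where $\lambda_1,\lambda_3<2^{\omega}$; (2) $(2^{\omega},\lambda_2,\lambda_3)$, where $\lambda_2,\lambda_3<2^{\omega}$. -/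

import Mathlib

open FirstOrder Cardinal

universe u v w

namespace CountableModels

/-- `T` is a complete theory in a countable language with continuum many complete types: `S(T)` is
the set of all complete types over the empty set in finitely many variables. -/
structure IsUnsmall {L : FirstOrder.Language.{u, v}} (T : L.Theory) : Prop where
  countable_language : Countable L.Symbols
  complete : T.IsComplete
  continuum_types : #(Σ n : ℕ, T.CompleteType (Fin n)) = 𝔠

/-- `M` is prime over the tuple `a`: whenever a tuple `b` of a structure `N` has the same complete
type as `a`, there is an elementary embedding of `M` into `N` that maps `a` to `b`. -/
def IsPrimeOver (L : FirstOrder.Language.{u, v}) {M : Type w} [L.Structure M] {n : ℕ} (a : Fin n → M) :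
    Prop :=
  ∀ (N : Type w) [L.Structure N] (b : Fin n → N),
    (∀ φ : L.Formula (Fin n), φ.Realize a ↔ φ.Realize b) →
      ∃ f : M ↪ₑ[L] N, ∀ i, f (a i) = b i

/-- `M` is a model of `T` that is prime over some finite tuple of its elements. -/
def IsPrimeOverTuple {L : FirstOrder.Language.{u, v}} (T : L.Theory) (M : Type w) [L.Structure M] : Prop :=
  M ⊨ T ∧ ∃ (n : ℕ) (a : Fin n → M), IsPrimeOver L a

/-- `M` is a limit model of `T`: it is not prime over a tuple, and it is the union of an
elementary chain `S 0 ≼ S 1 ≼ ⋯` of models of `T` that are prime over tuples. -/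
def IsLimitModel {L : FirstOrder.Language.{u, v}} (T : L.Theory) (M : Type w) [L.Structure M] : Prop :=
  ¬ IsPrimeOverTuple T M ∧
    ∃ S : ℕ → L.Substructure M,
      (∀ n, ∃ f : S n ↪ₑ[L] S (n + 1), ∀ x : S n, (f x : M) = x) ∧
      (∀ n, IsPrimeOverTuple T (S n)) ∧
      ∀ x : M, ∃ n, x ∈ S n

/-- The countable models of `T`; up to isomorphism their carriers may be taken in `Type`. (If `T`
has infinitely many types then every model of `T` is infinite, so these are the models of
cardinality `ℵ₀`.) -/
def CountableModel {L : FirstOrder.Language.{u, v}} (T : L.Theory) : Type (max u v 1) :=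
  {M : FirstOrder.Language.Theory.ModelType.{u, v, 0} T // Countable M}

/-- Isomorphism of countable models. -/
def isoSetoid {L : FirstOrder.Language.{u, v}} (T : L.Theory) : Setoid (CountableModel T) where
  r M N := Nonempty (M.1 ≃[L] N.1)
  iseqv :=
    { refl := fun M => ⟨FirstOrder.Language.Equiv.refl L M.1⟩
      symm := fun ⟨f⟩ => ⟨f.symm⟩
      trans := fun ⟨f⟩ ⟨g⟩ => ⟨g.comp f⟩ }

/-- The set of isomorphism types of countable models of `T`. -/
def IsoType {L : FirstOrder.Language.{u, v}} (T : L.Theory) : Type (max u v 1) :=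
  Quotient (isoSetoid T)

/-- The isomorphism types of the countable models that are prime over tuples. -/
def primeTypes {L : FirstOrder.Language.{u, v}} (T : L.Theory) : Set (IsoType T) :=
  {c | ∃ M : CountableModel T, Quotient.mk (isoSetoid T) M = c ∧ IsPrimeOverTuple T M.1}

/-- The isomorphism types of the countable models that are limit models. -/
def limitTypes {L : FirstOrder.Language.{u, v}} (T : L.Theory) : Set (IsoType T) :=
  {c | ∃ M : CountableModel T, Quotient.mk (isoSetoid T) M = c ∧ IsLimitModel T M.1}

/-- The isomorphism types of all other countable models. -/
def otherTypes {L : FirstOrder.Language.{u, v}} (T : L.Theory) : Set (IsoType T) :=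
  {c | c ∉ primeTypes T ∧ c ∉ limitTypes T}

/-- The triple of distribution of countable models `(P(T), L(T), NPL(T))`. -/
noncomputable def cm3 {L : FirstOrder.Language.{u, v}} (T : L.Theory) :
    Cardinal.{max u v 1} × Cardinal.{max u v 1} × Cardinal.{max u v 1} :=
  (#(primeTypes T), #(limitTypes T), #(otherTypes T))

end CountableModels

namespace CountableModels

open FirstOrder.Language

variable {L : FirstOrder.Language.{u, v}} {T : L.Theory}

/-! A countable model realizes only countably many types. Hence if every one of the continuum many
types is realized in some model from a class, that class has at least `𝔠` isomorphism types
(`continuum_le_mk_of_realizes`), so it is not a union of two classes smaller than `𝔠`.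

For (1), the class is prime or other: a tuple of a limit model already lies in a member of the
chain, which is prime over a tuple.

For (2), the class is limit or other, so each type needs a countable model that is not prime over a
tuple. Countable models prime over realizations of one type embed elementarily in each other, so
they realize the same countable set of types and omit some `m`-type. A countable elementary submodel
of a model realizing all types, closed under choosing such an omitted type for each of its tuples,
is prime over none of them. -/

/-- Two tuples, possibly of different structures, have the same type. -/
def SameType (L : FirstOrder.Language.{u, v}) {M N : Type*} [L.Structure M] [L.Structure N] {n : ℕ}
    (a : Fin n → M) (b : Fin n → N) : Prop :=
  ∀ φ : L.Formula (Fin n), φ.Realize a ↔ φ.Realize b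

/-- The tuple `a` realizes the complete type `p`. -/
def Realizes {M : Type*} [L.Structure M] {n : ℕ} (a : Fin n → M) (p : T.CompleteType (Fin n)) :
    Prop :=
  ∀ φ : L.Formula (Fin n), Formula.equivSentence φ ∈ p ↔ φ.Realize a

theorem SameType.symm {M N : Type*} [L.Structure M] [L.Structure N] {n : ℕ}
    {a : Fin n → M} {b : Fin n → N} (h : SameType L a b) : SameType L b a :=
  fun φ => (h φ).symm

theorem SameType.trans {M N K : Type*} [L.Structure M] [L.Structure N] [L.Structure K] {n : ℕ}
    {a : Fin n → M} {b : Fin n → N} {c : Fin n → K} (h : SameType L a b) (h' : SameType L b c) :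
    SameType L a c :=
  fun φ => (h φ).trans (h' φ)

theorem SameType.of_map {M N : Type*} [L.Structure M] [L.Structure N] (f : M ↪ₑ[L] N) {n : ℕ}
    (a : Fin n → M) : SameType L (f ∘ a) a :=
  fun φ => f.map_formula φ a

theorem Realizes.of_sameType {M N : Type*} [L.Structure M] [L.Structure N] {n : ℕ}
    {a : Fin n → M} {b : Fin n → N} {p : T.CompleteType (Fin n)} (h : Realizes a p)
    (h' : SameType L a b) : Realizes b p :=
  fun φ => (h φ).trans (h' φ)

theorem Realizes.unique {M : Type*} [L.Structure M] {n : ℕ} {a : Fin n → M}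
    {p q : T.CompleteType (Fin n)} (hp : Realizes a p) (hq : Realizes a q) : p = q := by
  refine SetLike.ext fun φ => ?_
  obtain ⟨ψ, rfl⟩ := Formula.equivSentence.surjective φ
  exact (hp ψ).trans (hq ψ).symm

theorem realizes_typeOf {M : Type*} [L.Structure M] [M ⊨ T] [Nonempty M] {n : ℕ} (a : Fin n → M) :
    Realizes a (T.typeOf a) :=
  fun _ => Theory.CompleteType.formula_mem_typeOf

/-! ### A model realizing all types, by compactness -/

theorem exists_realizes {n : ℕ} (p : T.CompleteType (Fin n)) :
    ∃ (M : Theory.ModelType.{u, v, max u v} T) (a : Fin n → M), Realizes a p := by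
  obtain ⟨M, a, rfl⟩ := Theory.exists_modelType_is_realized_in T p
  exact ⟨M, a, realizes_typeOf a⟩

/-- The sentence saying that a finite set of formulas is realized. -/
noncomputable def realizableSentence {n : ℕ} (F : Set (L.Formula (Fin n))) [Finite F] :
    L.Sentence :=
  ((Formula.iInf fun φ : F => φ.1).relabel (Sum.inr : Fin n → Empty ⊕ Fin n)).iExs (Fin n)

theorem realize_realizableSentence {n : ℕ} (F : Set (L.Formula (Fin n))) [Finite F]
    {K : Type*} [L.Structure K] :
    K ⊨ realizableSentence F ↔ ∃ b : Fin n → K, ∀ φ ∈ F, φ.Realize b := by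
  simp [realizableSentence, Sentence.Realize, Formula.realize_iExs, Formula.realize_relabel,
    Formula.realize_iInf, Function.comp_def]

/-- A finite part of a type is realized in every model of a complete theory. -/
theorem exists_realize_of_finite (hT : T.IsComplete) {M N : Type*} [L.Structure M] [L.Structure N]
    [M ⊨ T] [N ⊨ T] [Nonempty M] [Nonempty N] {n : ℕ} (a : Fin n → M)
    {F : Set (L.Formula (Fin n))} (hF : F.Finite) (ha : ∀ φ ∈ F, φ.Realize a) :
    ∃ b : Fin n → N, ∀ φ ∈ F, φ.Realize b := by
  have : Finite F := hF
  rw [← realize_realizableSentence, hT.realize_sentence_iff, ← hT.realize_sentence_iff _ M,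
    realize_realizableSentence]
  exact ⟨a, ha⟩

/-- A complete theory has a model that realizes all its types. -/
theorem exists_realizes_all (hT : T.IsComplete) :
    ∃ N : Theory.ModelType.{u, v, max u v} T,
      ∀ (n : ℕ) (p : T.CompleteType (Fin n)), ∃ a : Fin n → N, Realizes a p := by
  let I : Type (max u v) := Σ n : ℕ, T.CompleteType (Fin n)
  choose M v hv using fun i : I => exists_realizes i.2
  let α : Type (max u v) := Σ i : I, Fin i.1
  let sent (i : I) (φ : L.Formula (Fin i.1)) : L[[α]].Sentence :=
    Formula.equivSentence (φ.relabel fun k => (⟨i, k⟩ : α))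
  -- The index `none` carries `T`; any other index carries at most one sentence, so a finite set of
  -- indices constrains each tuple of constants by finitely many formulas.
  let S : Option (Σ i : I, L.Formula (Fin i.1)) → L[[α]].Theory := fun j =>
    j.elim ((L.lhomWithConstants α).onTheory T) fun j => {ψ | ψ = sent j.1 j.2 ∧ j.2.Realize (v j.1)}
  have hS : Theory.IsSatisfiable (⋃ j, S j) := by
    rw [Theory.isSatisfiable_iUnion_iff_isSatisfiable_iUnion_finset]
    intro t
    let M₀ := hT.1.some
    have hw (i : I) : ∃ w : Fin i.1 → M₀, ∀ φ : L.Formula (Fin i.1),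
        some ⟨i, φ⟩ ∈ t → φ.Realize (v i) → φ.Realize w := by
      have hfin : {φ : L.Formula (Fin i.1) | some ⟨i, φ⟩ ∈ t ∧ φ.Realize (v i)}.Finite := by
        refine Set.Finite.subset (t.finite_toSet.preimage
          (f := fun φ : L.Formula (Fin i.1) => some (⟨i, φ⟩ : Σ i : I, L.Formula (Fin i.1)))
          fun φ _ ψ _ h => ?_) fun φ hφ => hφ.1
        simpa using h
      obtain ⟨w, hw⟩ := exists_realize_of_finite hT (N := M₀) (v i) hfin fun φ hφ => hφ.2
      exact ⟨w, fun φ h h' => hw φ ⟨h, h'⟩⟩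
    choose w hw using hw
    let _ : (constantsOn α).Structure M₀ := constantsOn.structure fun x : α => w x.1 x.2
    have hM₀ : M₀ ⊨ (⋃ j ∈ t, S j : L[[α]].Theory) := by
      refine ⟨fun ψ hψ => ?_⟩
      simp only [Set.mem_iUnion] at hψ
      obtain ⟨_ | ⟨i, φ⟩, hj, hψ⟩ := hψ
      · exact ((LHom.onTheory_model (L.lhomWithConstants α) T).2 M₀.is_model).realize_of_mem ψ hψ
      · obtain ⟨rfl, hψ⟩ := hψ
        simp only [sent]
        rw [Formula.realize_equivSentence, Formula.realize_relabel]
        exact hw i φ hj hψ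
    exact ⟨Theory.ModelType.of _ M₀⟩
  obtain ⟨N⟩ := hS
  let _ : L.Structure N := (L.lhomWithConstants α).reduct N
  have : (L.lhomWithConstants α).IsExpansionOn N := LHom.isExpansionOn_reduct _ _
  have hNT : N ⊨ T := (LHom.onTheory_model (L.lhomWithConstants α) T).1
    (N.is_model.mono (Set.subset_iUnion S none))
  refine ⟨Theory.ModelType.of T N, fun n p => ?_⟩
  let i : I := ⟨n, p⟩
  let a : Fin n → N := fun k => (L.con (⟨i, k⟩ : α) : N)
  have ha (φ : L.Formula (Fin n)) (h : φ.Realize (v i)) : φ.Realize a := by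
    have h' : N ⊨ sent i φ :=
      N.is_model.realize_of_mem _ (Set.mem_iUnion.2 ⟨some ⟨i, φ⟩, rfl, h⟩)
    simp only [sent] at h'
    rw [Formula.realize_equivSentence, Formula.realize_relabel] at h'
    exact h'
  refine ⟨a, (hv i).of_sameType fun φ => ⟨ha φ, fun h => ?_⟩⟩
  by_contra h'
  exact (Formula.realize_not.1 (ha φ.not (Formula.realize_not.2 h'))) h

/-! ### Countable models that are not prime over a tuple -/

theorem countable_realized {K : Type*} [L.Structure K] [Countable K] (n : ℕ) :
    {p : T.CompleteType (Fin n) | ∃ a : Fin n → K, Realizes a p}.Countable := by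
  choose f hf using fun p : {p : T.CompleteType (Fin n) | ∃ a : Fin n → K, Realizes a p} => p.2
  refine Set.countable_coe_iff.1 (Function.Injective.countable (f := f) fun p q h => ?_)
  exact Subtype.ext ((hf p).unique (h ▸ hf q))

/-- If `N` realizes uncountably many types, then for each tuple `a` it contains a tuple whose type
is omitted in all countable structures that are prime over a tuple with the same type as `a`. -/
theorem exists_omitted_of_isPrimeOver {N : Type*} [L.Structure N] [Nonempty N] {m : ℕ}
    (hm : ¬ Countable (T.CompleteType (Fin m)))
    (hN : ∀ p : T.CompleteType (Fin m), ∃ a : Fin m → N, Realizes a p) {n : ℕ} (a : Fin n → N) :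
    ∃ c : Fin m → N, ∀ (K : Type) [L.Structure K] [Countable K] (k : Fin n → K), SameType L k a →
      IsPrimeOver L k → ∀ d : Fin m → K, ¬ SameType L d c := by
  -- One such structure `K₀` suffices: every other one embeds elementarily in it, so a type omitted
  -- in `K₀` is omitted in all.
  by_cases h : ∃ (K : Type) (_ : L.Structure K) (_ : Countable K) (k : Fin n → K),
      SameType L k a ∧ IsPrimeOver L k
  · obtain ⟨K₀, _, _, k₀, hk₀, -⟩ := h
    obtain ⟨p, hp⟩ : ∃ p : T.CompleteType (Fin m), ¬ ∃ d : Fin m → K₀, Realizes d p := by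
      by_contra! hp
      exact hm (Set.countable_univ_iff.1 ((countable_realized (K := K₀) m).mono fun p _ => hp p))
    obtain ⟨c, hc⟩ := hN p
    refine ⟨c, fun K _ _ k hk hprime d hd => hp ?_⟩
    obtain ⟨f, -⟩ := hprime K₀ k₀ (hk.trans hk₀.symm)
    exact ⟨f ∘ d, hc.of_sameType ((SameType.of_map f d).trans hd).symm⟩
  · exact ⟨fun _ => Classical.arbitrary N, fun K _ _ k hk hprime =>
      (h ⟨K, inferInstance, inferInstance, k, hk, hprime⟩).elim⟩

/-- A language with `m` function symbols of each arity. -/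
def functionLanguage (m : ℕ) : FirstOrder.Language.{0, 0} :=
  ⟨fun _ => Fin m, fun _ => Empty⟩

/-- Downward Löwenheim–Skolem in the language enlarged by symbols for the coordinates of `c`: its
substructures are closed under `c`, and the reduct to `L` stays elementary. -/
theorem exists_countable_closed [Countable L.Symbols] {N : Type w} [L.Structure N] [Infinite N]
    {m : ℕ} (c : ∀ n, (Fin n → N) → Fin m → N) (s : Set N) (hs : s.Countable) :
    ∃ S : L.ElementarySubstructure N, Countable S ∧ s ⊆ S ∧
      ∀ (n : ℕ) (x : Fin n → N), (∀ i, x i ∈ S) → ∀ i, c n x i ∈ S := by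
  let _ : (functionLanguage m).Structure N := ⟨fun {n} i x => c n x i, fun r => r.elim⟩
  have hcard : (L.sum (functionLanguage m)).card ≤ ℵ₀ := by
    rw [card_sum]
    have h1 : L.card ≤ ℵ₀ := Cardinal.mk_le_aleph0
    have h2 : (functionLanguage m).card ≤ ℵ₀ := by
      have : ∀ n, Countable ((functionLanguage m).Functions n) := fun n =>
        inferInstanceAs (Countable (Fin m))
      have : ∀ n, Countable ((functionLanguage m).Relations n) := fun n =>
        inferInstanceAs (Countable Empty)
      exact Cardinal.mk_le_aleph0
        (α := (Σ n, (functionLanguage m).Functions n) ⊕ (Σ n, (functionLanguage m).Relations n))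
    refine Cardinal.add_le_aleph0.2 ⟨?_, ?_⟩ <;> simpa
  obtain ⟨S, hsS, hS⟩ := exists_elementarySubstructure_card_eq (L.sum (functionLanguage m)) s
    (ℵ₀ : Cardinal.{w}) le_rfl (by simpa using hs.le_aleph0) (by simpa using hcard) (by simp)
  refine ⟨⟨LHom.sumInl.substructureReduct S.toSubstructure, fun n φ x => ?_⟩, ?_, hsS, ?_⟩
  · let _ : L.Structure S := (LHom.sumInl.substructureReduct S.toSubstructure).inducedStructure
    have : (LHom.sumInl : L →ᴸ L.sum (functionLanguage m)).IsExpansionOn S :=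
      { map_onFunction := fun _ _ => rfl
        map_onRelation := fun _ _ => rfl }
    have h := S.isElementary (LHom.sumInl.onFormula φ) x
    rw [LHom.realize_onFormula] at h
    exact h.trans (LHom.realize_onFormula (M := S) LHom.sumInl φ)
  · have : #S ≤ ℵ₀ := by simpa using hS.le
    exact Cardinal.mk_le_aleph0_iff.1 this
  · intro n x hx i
    exact S.toSubstructure.fun_mem (LHom.sumInr.onFunction (i : (functionLanguage m).Functions n)) x hx

theorem exists_not_countable_completeType (hT : IsUnsmall T) :
    ∃ m, ¬ Countable (T.CompleteType (Fin m)) := by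
  by_contra! h
  have h' : #(Σ n : ℕ, T.CompleteType (Fin n)) ≤ ℵ₀ := Cardinal.mk_le_aleph0
  rw [hT.continuum_types] at h'
  exact aleph0_lt_continuum.not_ge h'

/-- Every type of a theory with continuum many types is realized in a countable model that is not
prime over a tuple. -/
theorem exists_realizes_not_isPrimeOverTuple (hT : IsUnsmall T) {n : ℕ}
    (p : T.CompleteType (Fin n)) :
    ∃ M : CountableModel T, ¬ IsPrimeOverTuple T M.1 ∧ ∃ a : Fin n → M.1, Realizes a p := by
  have := hT.countable_language
  obtain ⟨m, hm⟩ := exists_not_countable_completeType hT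
  obtain ⟨N, hN⟩ := exists_realizes_all hT.complete
  have : Infinite N := by
    by_contra h
    have : Finite N := not_infinite_iff_finite.1 h
    exact hm (Set.countable_univ_iff.1
      ((countable_realized (K := N) m).mono fun q _ => hN m q))
  choose c hc using fun (k : ℕ) (a : Fin k → N) =>
    exists_omitted_of_isPrimeOver (T := T) hm (hN m) a
  obtain ⟨a, ha⟩ := hN n p
  obtain ⟨S, hS, haS, hcS⟩ := exists_countable_closed (L := L) c (Set.range a) (Set.countable_range a)
  -- Carriers of countable models lie in `Type`, so `S` is replaced by a copy there.
  let _ : L.Structure (Shrink.{0} S) := (equivShrink.{0} S).inducedStructure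
  let g : S ≃[L] Shrink.{0} S := (equivShrink.{0} S).inducedStructureEquiv
  have hST : S ⊨ T := inferInstance
  have hgT : Shrink.{0} S ⊨ T := StrongHomClass.theory_model g
  have : Nonempty (Shrink.{0} S) := (equivShrink.{0} S).symm.nonempty
  let e : Shrink.{0} S ↪ₑ[L] N := S.subtype.comp g.symm.toElementaryEmbedding
  have he (x : N) (hx : x ∈ S) : e (g ⟨x, hx⟩) = x := by simp [e]
  have hcount : Countable (Shrink.{0} S) := (equivShrink.{0} S).symm.injective.countable
  refine ⟨⟨Theory.ModelType.of T (Shrink.{0} S), hcount⟩, ?_, ?_⟩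
  · rintro ⟨-, k, b, hb⟩
    -- If the model were prime over `b`, it would omit the type of the tuple that `c` assigns to
    -- `b`; but that tuple lies in `S`.
    have hmem : ∀ i, c k (e ∘ b) i ∈ S := hcS k _ fun i => (g.symm (b i)).2
    refine hc k (e ∘ b) (Shrink.{0} S) b (SameType.of_map e b).symm hb
      (fun i => g ⟨_, hmem i⟩) ?_
    have := (SameType.of_map e fun i => g ⟨_, hmem i⟩).symm
    simp only [Function.comp_def, he] at this
    exact this
  · have hmem : ∀ i, a i ∈ S := fun i => haS ⟨i, rfl⟩
    refine ⟨fun i => g ⟨_, hmem i⟩, ha.of_sameType ?_⟩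
    have := SameType.of_map e fun i => g ⟨_, hmem i⟩
    simp only [Function.comp_def, he] at this
    exact this

/-! ### Elementary chains -/

/-- Tarski's elementary chain theorem, for chains of substructures. -/
theorem isElementary_of_chain {M : Type w} [L.Structure M] (S : ℕ → L.Substructure M)
    (hS : ∀ n, ∃ f : S n ↪ₑ[L] S (n + 1), ∀ x : S n, (f x : M) = x)
    (hM : ∀ x : M, ∃ n, x ∈ S n) (n : ℕ) : (S n).IsElementary := by
  have hle : ∀ {n m : ℕ}, n ≤ m → ∃ f : S n ↪ₑ[L] S m, ∀ x : S n, (f x : M) = x := by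
    intro n m h
    induction m, h using Nat.le_induction with
    | base => exact ⟨ElementaryEmbedding.refl L (S n), fun _ => rfl⟩
    | succ m _ ih =>
      obtain ⟨f, hf⟩ := ih
      obtain ⟨g, hg⟩ := hS m
      exact ⟨g.comp f, fun x => (hg (f x)).trans (hf x)⟩
  -- The claim covers all `n` at once, since the quantifier step moves to a later member of the
  -- chain containing the new element.
  have key : ∀ {α : Type} {k : ℕ} (φ : L.BoundedFormula α k) (n : ℕ) (y : α → S n)
      (x : Fin k → S n), φ.Realize (fun i => (y i : M)) (fun i => (x i : M)) ↔ φ.Realize y x := by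
    intro α k φ
    induction φ with
    | falsum => intro n y x; rfl
    | equal t₁ t₂ =>
      intro n y x
      exact (BoundedFormula.IsAtomic.equal t₁ t₂).isQF.realize_embedding (S n).subtype
    | rel R ts =>
      intro n y x
      exact (BoundedFormula.IsAtomic.rel R ts).isQF.realize_embedding (S n).subtype
    | imp φ ψ ihφ ihψ =>
      intro n y x
      rw [BoundedFormula.realize_imp, BoundedFormula.realize_imp, ihφ, ihψ]
    | all φ ih =>
      intro n y x
      refine ⟨fun h z => ?_, fun h z => ?_⟩
      · have := h z
        rw [← ih]
        convert this using 1
        exact Fin.comp_snoc (fun z : S n => (z : M)) x z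
      · obtain ⟨m, hm⟩ := hM z
        obtain ⟨f, hf⟩ := hle (le_max_left n m)
        obtain ⟨g, hg⟩ := hle (le_max_right n m)
        have h' := (f.map_boundedFormula _ y x).2 h (g ⟨z, hm⟩)
        rw [← ih] at h'
        convert h' using 1
        · funext i; exact (hf _).symm
        · rw [← Function.comp_def (fun z : S (max n m) => (z : M)), Fin.comp_snoc, hg]
          congr 1
          funext i; exact (hf _).symm
  intro k φ x
  rw [Formula.Realize, Formula.Realize, ← key φ n x default]
  exact iff_of_eq (congrArg _ (Subsingleton.elim _ _))

theorem isPrimeOverTuple_of_equiv {M N : Type w} [L.Structure M] [L.Structure N] (f : M ≃[L] N)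
    (h : IsPrimeOverTuple T M) : IsPrimeOverTuple T N := by
  obtain ⟨hM, n, a, ha⟩ := h
  refine ⟨StrongHomClass.theory_model f, n, f ∘ a, fun K _ b hb => ?_⟩
  obtain ⟨g, hg⟩ := ha K b ((SameType.of_map f.toElementaryEmbedding a).symm.trans hb)
  exact ⟨g.comp f.symm.toElementaryEmbedding, fun i => by simp [hg]⟩

/-! ### Counting isomorphism types -/

/-- If all types are realized in models whose isomorphism types belong to `X`, then `X` has at least
continuum many elements. -/
theorem continuum_le_mk_of_realizes (hT : IsUnsmall T) (X : Set (IsoType T))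
    (hX : ∀ (n : ℕ) (p : T.CompleteType (Fin n)), ∃ M : CountableModel T,
      Quotient.mk (isoSetoid T) M ∈ X ∧ ∃ a : Fin n → M.1, Realizes a p) : 𝔠 ≤ #X := by
  let I := Σ n : ℕ, T.CompleteType (Fin n)
  have hX' : ∀ i : I, ∃ c : X, ∃ a : Fin i.1 → (Quotient.out c.1).1, Realizes a i.2 := by
    rintro ⟨n, p⟩
    obtain ⟨M, hM, a, ha⟩ := hX n p
    refine ⟨⟨_, hM⟩, ?_⟩
    obtain ⟨f⟩ : Nonempty ((Quotient.out (Quotient.mk (isoSetoid T) M)).1 ≃[L] M.1) :=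
      Quotient.exact (s := isoSetoid T) (Quotient.out_eq _)
    exact ⟨f.symm ∘ a, ha.of_sameType (SameType.of_map f.symm.toElementaryEmbedding a).symm⟩
  choose c hc using hX'
  have hcount : ∀ x : X, ∃ g : I → ℕ,
      Set.InjOn g {i | ∃ a : Fin i.1 → (Quotient.out x.1).1, Realizes a i.2} := by
    intro x
    have := (Quotient.out x.1).2
    rw [← Set.countable_iff_exists_injOn]
    refine (Set.countable_iUnion fun n : ℕ =>
      (countable_realized (T := T) (K := (Quotient.out x.1).1) n).image (Sigma.mk n : _ → I)).mono ?_
    rintro ⟨n, p⟩ hp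
    exact Set.mem_iUnion.2 ⟨n, p, hp, rfl⟩
  choose g hg using hcount
  -- A type is determined by a model realizing it and its number there, so `𝔠 ≤ #X * ℵ₀`, which
  -- fails if `#X < 𝔠`.
  have hinj : Function.Injective fun i : I => (c i, g (c i) i) := by
    intro i j h
    obtain ⟨h₁, h₂⟩ := Prod.mk_inj.1 h
    have hj := hc j
    rw [← h₁] at h₂ hj
    exact hg (c i) (hc i) hj h₂
  have hle := Cardinal.mk_le_of_injective
    (Function.Injective.comp hinj Equiv.ulift.{max u v 1}.injective)
  rw [mk_uLift, hT.continuum_types, lift_continuum, mk_prod] at hle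
  by_contra! hlt
  refine hle.not_gt (mul_lt_of_lt aleph0_le_continuum ?_ ?_)
  · simpa using hlt
  · simpa only [mk_nat, lift_aleph0] using aleph0_lt_continuum

theorem IsLimitModel.exists_isPrimeOverTuple_realizes {M : Type} [L.Structure M] [Countable M]
    [Nonempty M] (h : IsLimitModel T M) {n : ℕ} {p : T.CompleteType (Fin n)} {a : Fin n → M}
    (ha : Realizes a p) :
    ∃ K : CountableModel T, IsPrimeOverTuple T K.1 ∧ ∃ b : Fin n → K.1, Realizes b p := by
  obtain ⟨-, S, hS, hprime, hM⟩ := h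
  have hmono : Monotone S := monotone_nat_of_le_succ fun n x hx => by
    obtain ⟨f, hf⟩ := hS n
    have := (f ⟨x, hx⟩).2
    rwa [hf] at this
  obtain ⟨x⟩ := ‹Nonempty M›
  obtain ⟨k₀, hk₀⟩ := hM x
  choose k hk using fun i => hM (a i)
  -- Including `k₀` keeps `S m` nonempty even when `n = 0`.
  let m := k₀ ⊔ Finset.univ.sup k
  have hx : x ∈ S m := hmono le_sup_left hk₀
  have ham : ∀ i, a i ∈ S m := fun i =>
    hmono ((Finset.le_sup (Finset.mem_univ i)).trans le_sup_right) (hk i)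
  have : Nonempty (S m) := ⟨⟨x, hx⟩⟩
  have : S m ⊨ T := (hprime m).1
  have hcount : Countable (S m) := inferInstance
  refine ⟨⟨Theory.ModelType.of T (S m), hcount⟩, hprime m, fun i => ⟨a i, ham i⟩,
    ha.of_sameType fun φ => ?_⟩
  exact isElementary_of_chain S hS hM m φ fun i => ⟨a i, ham i⟩

theorem continuum_le_mk_primeTypes_union_otherTypes (hT : IsUnsmall T) :
    𝔠 ≤ #(primeTypes T ∪ otherTypes T : Set (IsoType T)) := by
  refine continuum_le_mk_of_realizes hT _ fun n p => ?_
  -- Any countable model realizing `p` would do here; that it is not prime over a tuple is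
  -- discarded.
  obtain ⟨M, -, a, ha⟩ := exists_realizes_not_isPrimeOverTuple hT p
  by_cases hlim : Quotient.mk (isoSetoid T) M ∈ limitTypes T
  · obtain ⟨M', hM', h⟩ := hlim
    obtain ⟨f⟩ : Nonempty (M'.1 ≃[L] M.1) := Quotient.exact hM'
    have := M'.2
    obtain ⟨K, hK, b, hb⟩ := h.exists_isPrimeOverTuple_realizes
      (ha.of_sameType (SameType.of_map f.symm.toElementaryEmbedding a).symm)
    exact ⟨K, Or.inl ⟨K, rfl, hK⟩, b, hb⟩
  · exact ⟨M, or_iff_not_imp_left.2 fun h => ⟨h, hlim⟩, a, ha⟩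

theorem continuum_le_mk_limitTypes_union_otherTypes (hT : IsUnsmall T) :
    𝔠 ≤ #(limitTypes T ∪ otherTypes T : Set (IsoType T)) := by
  refine continuum_le_mk_of_realizes hT _ fun n p => ?_
  obtain ⟨M, hM, a, ha⟩ := exists_realizes_not_isPrimeOverTuple hT p
  refine ⟨M, or_iff_not_imp_left.2 fun h => ⟨?_, h⟩, a, ha⟩
  rintro ⟨M', hM', h'⟩
  obtain ⟨f⟩ : Nonempty (M'.1 ≃[L] M.1) := Quotient.exact hM'
  exact hM (isPrimeOverTuple_of_equiv f h')

end CountableModels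

theorem proposition5p4 {L : FirstOrder.Language.{u, v}} (T : L.Theory)
    (hT : CountableModels.IsUnsmall T) :
    (¬ ∃ κ₁ κ₃ : Cardinal.{max u v 1}, κ₁ < 𝔠 ∧ κ₃ < 𝔠 ∧
      CountableModels.cm3 T = (κ₁, 𝔠, κ₃)) ∧
    (¬ ∃ κ₂ κ₃ : Cardinal.{max u v 1}, κ₂ < 𝔠 ∧ κ₃ < 𝔠 ∧
      CountableModels.cm3 T = (𝔠, κ₂, κ₃)) := by
  constructor
  · rintro ⟨κ₁, κ₃, h₁, h₃, h⟩
    simp only [CountableModels.cm3, Prod.mk.injEq] at h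
    obtain ⟨rfl, -, rfl⟩ := h
    exact (CountableModels.continuum_le_mk_primeTypes_union_otherTypes hT).not_gt
      ((mk_union_le _ _).trans_lt (add_lt_of_lt aleph0_le_continuum h₁ h₃))
  · rintro ⟨κ₂, κ₃, h₂, h₃, h⟩
    simp only [CountableModels.cm3, Prod.mk.injEq] at h
    obtain ⟨-, rfl, rfl⟩ := h
    exact (CountableModels.continuum_le_mk_limitTypes_union_otherTypes hT).not_gt
      ((mk_union_le _ _).trans_lt (add_lt_of_lt aleph0_le_continuum h₂ h₃))
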